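/- Notation. For positive integers $a,b,d$ let $\frac{\langle a,b\rangle}{d}=\{x\in\mathbb N : dx\in\langle a,b\rangle\}$, where $\langle a,b\rangle=\{ia+jb : i,j\in\mathbb N\}$. For a submonoid $S$ of $\mathbb N$, $\mathrm{Irr}(S)$ is the set of positive elements of $S$ that are not a sum of two positive elements of $S$. A set $A$ is $\mathbb N$-independent if no $a\in A$ lies in the submonoid generated by $A\setminus\{a\}$. An integer sequence $(n_i)_{s\le i\le t}$ is modular-convex if for each $s<i<t$ there is $k_i\in\mathbb N$ with $n_{i-1}+n_{i+1}-2n_i=k_in_i$. For integers $c_1,\dots,c_k\ge 2$ put $\lceil c_1,\dots,c_k\rceil=c_1-\cfrac{1}{c_2-\cfrac{1}{c_3-\cdots}}$. Theorem. Let $I$ be a finite $\mathbb N$-independent subset of $\mathbb N\setminus\{0,1\}$ that is enumerated (without repetition) by a modular-convex sequence $(n_i)_{0\le i\le r}$, $r\ge 1$, with $\gcd(n_0,n_1)=1$. Let $(d_i)_{1\le i\le r-1}$ be the integers $d_i\ge 2$ with $n_{i+1}=d_in_i-n_{i-1}$ for $1\le i\le r-1$. (i) Let $\nu<0$ and $\rho>r$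 be integers, and extend $(d_i)_{1\le i\le r-1}$ to a sequence $(d_i)_{\nu+1\le i\le\rho-1}$ of integers $\ge 2$ such that the extension $(n_i)_{\nu\le i\le\rho}$ of $(n_i)_{0\le i\le r}$ defined by $n_{i+1}=d_in_i-n_{i-1}$ ($\nu<i<\rho$) consists of positive integers. Let $\frac dm=\lceil d_{\nu+1},\dots,d_{\rho-1}\rceil$ and $\frac{q_i}{p_i}=\lceil d_{\nu+1},\dots,d_i\rceil$ ($\nu<i<\rho$) be reduced fractions, let $q_{\nu-1}=0$, $q_\nu=1$, $p_{\nu-1}=-1$, $p_\nu=0$, and put $a=n_\nu$, $b=dn_{\nu+1}-mn_\nu$ and $x_i=mq_{i-1}-dp_{i-1}$ for $\nu\le i\le\rho$. Then $n_\rho=b$. Moreover, if $$\gcd(a,b)=1,\qquad a\le q_r,\qquad a<b<d,\qquad x_0<x_r+b\le x_{-1},$$ then $a,b,d$ are pairwise coprime and $\mathrm{Irr}\left(\frac{\langle a,b\rangle}{d}\right)=I$. (ii) Every triple $(a,b,d)$ of pairwise coprime positive integers with $a<b<d$ and $\mathrm{Irr}\left(\frac{\langle a,b\rangle}{d}\right)=I$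 is obtained as in (i), with all the conditions there satisfied, from some modular-convex enumeration of $I$ whose first two terms are coprime. (iii) For the given enumeration $(n_i)_{0\le i\le r}$ there are infinitely many triples $(a,b,d)$ of pairwise coprime positive integers with $a<b<d$ and $\mathrm{Irr}\left(\frac{\langle a,b\rangle}{d}\right)=I$ that are obtained as in (i), with all the conditions there satisfied, with $\nu=-1$ and $\rho=r+1$. -/

import Mathlib

/-- A subset `A` of a monoid is `ℕ`-independent if no element `a` of `A` lies in the submonoid
generated by `A \ {a}`. -/
def NIndependent {M : Type*} [AddMonoid M] (A : Set M) : Prop :=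
  ∀ a ∈ A, a ∉ AddSubmonoid.closure (A \ {a})

/-- The quotient `S / d = {x ∈ ℕ : d x ∈ S}` of a submonoid `S` of `ℕ`. -/
def semigroupQuot (S : AddSubmonoid ℕ) (d : ℕ) : AddSubmonoid ℕ :=
  S.comap (AddMonoidHom.mulLeft d)

/-- The set of irreducible elements of a submonoid of `ℕ`: the positive elements that are not a sum
of two positive elements. -/
def irr (S : AddSubmonoid ℕ) : Set ℕ :=
  {s | s ∈ S ∧ 0 < s ∧ ∀ u ∈ S, ∀ v ∈ S, 0 < u → 0 < v → s ≠ u + v}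

/-- The sequence `(u_i)`, `s ≤ i ≤ t`, is modular-convex: its discrete second derivative is `k · u`
for some sequence `k` with values in `ℕ`. -/
def ModularConvexOn {M : Type*} [AddCommGroup M] (u : ℤ → M) (s t : ℤ) : Prop :=
  ∃ k : ℤ → ℕ, ∀ i, s < i → i < t → u (i - 1) + u (i + 1) - 2 • u i = k i • u i

/-- `(n_k)`, `0 ≤ k ≤ r`, is a modular-convex enumeration of `I` whose first two terms are
coprime. -/
structure IsModularConvexEnum (I : Finset ℕ) (r : ℤ) (n : ℤ → ℤ) : Prop where
  one_le : 1 ≤ r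
  bijOn : Set.BijOn n (Set.Icc 0 r) ((fun k : ℕ => (k : ℤ)) '' (I : Set ℕ))
  modularConvex : ModularConvexOn n 0 r
  coprime : IsCoprime (n 0) (n 1)

/-- `(c_i)`, `s < i < t`, are integers at least `2` with `n_{i+1} = c_i n_i - n_{i-1}`. -/
def IsCoeffSeq (c n : ℤ → ℤ) (s t : ℤ) : Prop :=
  ∀ i, s < i → i < t → 2 ≤ c i ∧ n (i + 1) = c i * n i - n (i - 1)

/-- `(n'_i)`, `ν ≤ i ≤ ρ`, with coefficients `(c'_i)`, `ν < i < ρ`, is a two-sided extension of the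
sequence `(n_i)`, `0 ≤ i ≤ r`, with coefficients `(c_i)`, `0 < i < r`, by a modular-convex sequence
of positive integers. -/
structure IsTwoSidedExtension (r : ℤ) (n c : ℤ → ℤ) (ν ρ : ℤ) (n' c' : ℤ → ℤ) : Prop where
  left : ν < 0
  right : r < ρ
  coeff_eq : ∀ i, 0 < i → i < r → c' i = c i
  seq_eq : ∀ i, 0 ≤ i → i ≤ r → n' i = n i
  coeffSeq : IsCoeffSeq c' n' ν ρ
  pos : ∀ i, ν ≤ i → i ≤ ρ → 0 < n' i

/-- The value of the ceiling continued fraction `⌈c₁, …, c_k⌉ = c₁ - 1 / (c₂ - 1 / (c₃ - ⋯))` of a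
nonempty list (the value `0` of the empty list, with `0⁻¹ = 0`, makes `⌈c₁⌉ = c₁`). -/
def ceilCF : List ℤ → ℚ
  | [] => 0
  | c :: l => (c : ℚ) - (ceilCF l)⁻¹

/-- The list `c_s, c_{s+1}, …, c_t`. -/
def coeffList (c : ℤ → ℤ) (s t : ℤ) : List ℤ :=
  (List.range (t + 1 - s).toNat).map fun k => c (s + k)

/-- `q_i`: the numerator of the reduced fraction of `⌈c_{ν+1}, …, c_i⌉` for `i > ν`,
and `q_{ν-1} = 0`, `q_ν = 1`. -/
def convNum (c : ℤ → ℤ) (ν i : ℤ) : ℤ :=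
  if i = ν - 1 then 0 else if i = ν then 1 else (ceilCF (coeffList c (ν + 1) i)).num

/-- `p_i`: the denominator of the reduced fraction of `⌈c_{ν+1}, …, c_i⌉` for `i > ν`,
and `p_{ν-1} = -1`, `p_ν = 0`. -/
def convDen (c : ℤ → ℤ) (ν i : ℤ) : ℤ :=
  if i = ν - 1 then -1 else if i = ν then 0 else ((ceilCF (coeffList c (ν + 1) i)).den : ℤ)

/-- `d`, the numerator of the reduced fraction `d / m = ⌈c_{ν+1}, …, c_{ρ-1}⌉`. -/
def extD (c : ℤ → ℤ) (ν ρ : ℤ) : ℤ := (ceilCF (coeffList c (ν + 1) (ρ - 1))).num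

/-- `m`, the denominator of the reduced fraction `d / m = ⌈c_{ν+1}, …, c_{ρ-1}⌉`. -/
def extM (c : ℤ → ℤ) (ν ρ : ℤ) : ℤ := ((ceilCF (coeffList c (ν + 1) (ρ - 1))).den : ℤ)

/-- `b = d n_{ν+1} - m n_ν`. -/
def extB (n c : ℤ → ℤ) (ν ρ : ℤ) : ℤ := extD c ν ρ * n (ν + 1) - extM c ν ρ * n ν

/-- `x_i = m q_{i-1} - d p_{i-1}`. -/
def extX (c : ℤ → ℤ) (ν ρ i : ℤ) : ℤ :=
  extM c ν ρ * convNum c ν (i - 1) - extD c ν ρ * convDen c ν (i - 1)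

/-- `(a, b, d)` is the triple attached to the extended sequence:
`a = n_ν`, `b = d n_{ν+1} - m n_ν` and `d / m = ⌈c_{ν+1}, …, c_{ρ-1}⌉`. -/
def IsExtTriple (n c : ℤ → ℤ) (ν ρ : ℤ) (a b d : ℕ) : Prop :=
  (a : ℤ) = n ν ∧ (b : ℤ) = extB n c ν ρ ∧ (d : ℤ) = extD c ν ρ

/-- The conditions `gcd(a, b) = 1`, `a ≤ q_r`, `a < b < d` and `x_0 < x_r + b ≤ x_{-1}`. -/
def TripleConditions (r : ℤ) (c : ℤ → ℤ) (ν ρ : ℤ) (a b d : ℕ) : Prop :=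
  Nat.Coprime a b ∧ (a : ℤ) ≤ convNum c ν r ∧ a < b ∧ b < d ∧
    extX c ν ρ 0 < extX c ν ρ r + b ∧ extX c ν ρ r + b ≤ extX c ν ρ (-1)

/-- `(a, b, d)` is obtained from the sequence `(n_i)`, `0 ≤ i ≤ r`, with coefficients `(c_i)`, by an
extension to the index set `{ν, …, ρ}` which satisfies the conditions. -/
def IsObtained (r : ℤ) (n c : ℤ → ℤ) (ν ρ : ℤ) (a b d : ℕ) : Prop :=
  ∃ n' c' : ℤ → ℤ, IsTwoSidedExtension r n c ν ρ n' c' ∧ IsExtTriple n' c' ν ρ a b d ∧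
    TripleConditions r c' ν ρ a b d

/-- `a, b, d` are pairwise coprime positive integers with `a < b < d` and
`Irr(⟨a, b⟩ / d) = I`. -/
def IsSolution (I : Finset ℕ) (a b d : ℕ) : Prop :=
  0 < a ∧ a < b ∧ b < d ∧ Nat.Coprime a b ∧ Nat.Coprime a d ∧ Nat.Coprime b d ∧
    irr (semigroupQuot (AddSubmonoid.closure {a, b}) d) = (I : Set ℕ)

/-! Let `L` be the lattice of all `(X, Y)` with `d ∣ a X + b Y`. The value `(a X + b Y) / d` maps
the points of `L` in the quadrant onto `⟨a, b⟩ / d`, and it is invariant under translation by `(b,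
-a)`. The points `(x_i, y_i)` with `y_i = q_{i-1}` form a Hirzebruch–Jung chain in `L` from `(d, 0)`
to `(0, d)`, and `n_i` is the value at `(x_i, y_i)`. Consecutive points have determinant `d`, so for
`a` prime to `d` they form a basis of `L`. Hence every point of `L` in the quadrant is a nonnegative
combination of two neighbours (`exists_combination`), and the `n_i` generate `⟨a, b⟩ / d`.

Translation removes superfluous generators. If `a ≤ y_{t+1}` and `x_t + b ≤ x_{s-1}`, a chain point
outside `[s, t]` can be moved within the quadrant to a point composed of chain points nearer to `[s,
t]`, so the indices in `[s, t]` suffice (`n_mem_closure`). With `s = 0` and `t = r` this is (i),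
since an independent generating set consists of the irreducible elements.

Conversely, expand `d / m` with `a m + b ≡ 0` modulo `d`. Take `t` greatest with `y_t ≤ a` and `s`
least with `x_s < x_t + b`. The values on `[s, t]` are then irreducible and distinct (`mem_irr`,
`eq_of_n_eq`), and shifting the index by `s` gives (ii).

For (iii), one term is added on each side, and the right one is a large prime `p ≡ -n_{r-1}` modulo
`n_r`, supplied by Dirichlet's theorem. Primality gives coprimality with `a`, and independence of
`I` gives `x_0 < x_r + b`. -/

/-! ### Continuants and the value of a ceiling continued fraction -/

/-- The continuant `K(c_s, …, c_{s+k-1})` of ceiling continued fractions. -/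
def continuant (c : ℤ → ℤ) (s : ℤ) : ℕ → ℤ
  | 0 => 1
  | 1 => c s
  | k + 2 => c (s + k + 1) * continuant c s (k + 1) - continuant c s k

theorem continuant_succ_succ (c : ℤ → ℤ) (s : ℤ) (k : ℕ) :
    continuant c s (k + 2) = c (s + k + 1) * continuant c s (k + 1) - continuant c s k := rfl

/-- The recurrence of continuants at the left end. -/
theorem continuant_front (c : ℤ → ℤ) (s : ℤ) (k : ℕ) :
    continuant c s (k + 2) = c s * continuant c (s + 1) (k + 1) - continuant c (s + 2) k := by
  induction k using Nat.strong_induction_on with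
  | _ k ih =>
    match k, ih with
    | 0, _ => simp [continuant]; ring
    | 1, _ =>
      simp only [continuant]
      push_cast
      ring_nf
    | k + 2, ih =>
      rw [continuant_succ_succ, ih (k + 1) (by omega), ih k (by omega),
        continuant_succ_succ c (s + 1) (k + 1), continuant_succ_succ c (s + 2) k]
      push_cast
      have e1 : s + 1 + ((k : ℤ) + 1) + 1 = s + ((k : ℤ) + 2) + 1 := by ring
      have e2 : s + 2 + (k : ℤ) + 1 = s + ((k : ℤ) + 2) + 1 := by ring
      rw [e1, e2]
      ring

theorem continuant_pos_lt (c : ℤ → ℤ) (k : ℕ) :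
    ∀ s : ℤ, (∀ i, s ≤ i → i ≤ s + k → 2 ≤ c i) →
      0 < continuant c (s + 1) k ∧ continuant c (s + 1) k < continuant c s (k + 1) := by
  induction k with
  | zero =>
    intro s h
    have := h s le_rfl (by simp)
    simp only [continuant]
    omega
  | succ k ih =>
    intro s h
    have hs := h s le_rfl (by push_cast; omega)
    obtain ⟨h1, h2⟩ := ih (s + 1) fun i hi hi' => h i (by omega) (by push_cast; omega)
    rw [show s + 1 + 1 = s + 2 by ring] at h1 h2
    refine ⟨h1.trans h2, ?_⟩
    rw [continuant_front]
    nlinarith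

theorem isCoprime_continuant (c : ℤ → ℤ) (k : ℕ) :
    ∀ s : ℤ, IsCoprime (continuant c s (k + 1)) (continuant c (s + 1) k) := by
  induction k with
  | zero => intro s; exact isCoprime_one_right
  | succ k ih =>
    intro s
    obtain ⟨u, v, h⟩ := ih (s + 1)
    rw [show s + 1 + 1 = s + 2 by ring] at h
    refine ⟨-v, u + v * c s, ?_⟩
    rw [continuant_front]
    linear_combination h

/-- `ceilCF` peels off its first entry, so the induction runs on the left-end recurrence
`continuant_front`. -/
theorem ceilCF_range (c : ℤ → ℤ) (k : ℕ) :
    ∀ s : ℤ, (∀ i, s ≤ i → i ≤ s + k → 2 ≤ c i) →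
      ceilCF ((List.range (k + 1)).map fun j => c (s + (j : ℕ))) =
        (continuant c s (k + 1) : ℚ) / (continuant c (s + 1) k : ℚ) := by
  induction k with
  | zero => intro s _; simp [ceilCF, continuant]
  | succ k ih =>
    intro s h
    have hs : ∀ i, s + 1 ≤ i → i ≤ s + 1 + k → 2 ≤ c i :=
      fun i hi hi' => h i (by omega) (by push_cast; omega)
    have h1 := ih (s + 1) hs
    obtain ⟨h2, h3⟩ := continuant_pos_lt c k (s + 1) hs
    rw [show s + 1 + 1 = s + 2 by ring] at h1 h2 h3
    rw [List.range_succ_eq_map, List.map_cons, List.map_map, ceilCF]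
    have e : ((fun j : ℕ => c (s + (j : ℤ))) ∘ Nat.succ) = fun j : ℕ => c (s + 1 + (j : ℤ)) := by
      funext j
      simp only [Function.comp, Nat.succ_eq_add_one]
      push_cast
      ring_nf
    rw [e, h1, continuant_front]
    have h4 : (continuant c (s + 1) (k + 1) : ℚ) ≠ 0 := by
      exact_mod_cast (h2.trans h3).ne'
    have h5 : (continuant c (s + 2) k : ℚ) ≠ 0 := by exact_mod_cast h2.ne'
    push_cast
    simp only [add_zero]
    field_simp

theorem coeffList_eq (c : ℤ → ℤ) (s : ℤ) (k : ℕ) :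
    coeffList c s (s + k) = (List.range (k + 1)).map fun j => c (s + (j : ℕ)) := by
  unfold coeffList
  rw [show (s + k + 1 - s).toNat = k + 1 by omega, List.bind_eq_flatMap, List.map_flatMap]
  simp only [List.pure_def, List.map_cons, List.map_nil]
  exact List.flatMap_pure_eq_map _ _

theorem ceilCF_coeffList_num_den (c : ℤ → ℤ) (s : ℤ) (k : ℕ)
    (h : ∀ i, s ≤ i → i ≤ s + k → 2 ≤ c i) :
    (ceilCF (coeffList c s (s + k))).num = continuant c s (k + 1) ∧
      ((ceilCF (coeffList c s (s + k))).den : ℤ) = continuant c (s + 1) k := by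
  rw [coeffList_eq, ceilCF_range c k s h]
  have h1 := (continuant_pos_lt c k s h).1
  have h2 := Int.isCoprime_iff_gcd_eq_one.1 (isCoprime_continuant c k s)
  exact ⟨Rat.num_div_eq_of_coprime h1 h2, Rat.den_div_eq_of_coprime h1 h2⟩

/-! ### Recurrences of the convergents -/

theorem convNum_pred (c : ℤ → ℤ) (ν : ℤ) : convNum c ν (ν - 1) = 0 := by simp [convNum]

theorem convNum_self (c : ℤ → ℤ) (ν : ℤ) : convNum c ν ν = 1 := by
  rw [convNum, if_neg (by omega), if_pos rfl]

theorem convDen_pred (c : ℤ → ℤ) (ν : ℤ) : convDen c ν (ν - 1) = -1 := by simp [convDen]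

theorem convDen_self (c : ℤ → ℤ) (ν : ℤ) : convDen c ν ν = 0 := by
  rw [convDen, if_neg (by omega), if_pos rfl]

theorem convNum_add (c : ℤ → ℤ) (ν : ℤ) (k : ℕ) (h : ∀ i, ν < i → i ≤ ν + k → 2 ≤ c i) :
    convNum c ν (ν + k) = continuant c (ν + 1) k := by
  cases k with
  | zero => simp [convNum_self, continuant]
  | succ k =>
    have := (ceilCF_coeffList_num_den c (ν + 1) k fun i hi hi' =>
      h i (by omega) (by push_cast; omega)).1
    rw [convNum, if_neg (by omega), if_neg (by push_cast; omega), ← this]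
    push_cast
    ring_nf

theorem convDen_add (c : ℤ → ℤ) (ν : ℤ) (k : ℕ) (h : ∀ i, ν < i → i ≤ ν + k + 1 → 2 ≤ c i) :
    convDen c ν (ν + k + 1) = continuant c (ν + 2) k := by
  have := (ceilCF_coeffList_num_den c (ν + 1) k fun i hi hi' =>
      h i (by omega) (by omega)).2
  rw [convDen, if_neg (by omega), if_neg (by omega), show ν + 2 = ν + 1 + 1 by ring, ← this]
  ring_nf

theorem convNum_succ (c : ℤ → ℤ) (ν i : ℤ) (hi : ν ≤ i) (h : ∀ j, ν < j → j ≤ i + 1 → 2 ≤ c j) :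
    convNum c ν (i + 1) = c (i + 1) * convNum c ν i - convNum c ν (i - 1) := by
  obtain ⟨k, rfl⟩ := Int.le.dest hi
  cases k with
  | zero =>
    have := convNum_add c ν 1 fun j h1 h2 => h j h1 (by push_cast at h2 ⊢; omega)
    simp only [Nat.cast_zero, add_zero, Nat.cast_one] at this ⊢
    rw [this, convNum_self, convNum_pred]
    simp [continuant]
  | succ k =>
    have h0 := convNum_add c ν k fun j h1 h2 => h j h1 (by push_cast at h2 ⊢; omega)
    have h1 := convNum_add c ν (k + 1) fun j h1 h2 => h j h1 (by push_cast at h2 ⊢; omega)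
    have h2 := convNum_add c ν (k + 2) fun j h1 h2 => h j h1 (by push_cast at h2 ⊢; omega)
    rw [continuant_succ_succ, ← h0, ← h1] at h2
    push_cast at h2 ⊢
    ring_nf at h2 ⊢
    exact h2

theorem convDen_succ (c : ℤ → ℤ) (ν i : ℤ) (hi : ν ≤ i) (h : ∀ j, ν < j → j ≤ i + 1 → 2 ≤ c j) :
    convDen c ν (i + 1) = c (i + 1) * convDen c ν i - convDen c ν (i - 1) := by
  obtain ⟨k, rfl⟩ := Int.le.dest hi
  match k with
  | 0 =>
    have := convDen_add c ν 0 fun j h1 h2 => h j h1 (by push_cast at h2 ⊢; omega)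
    simp only [Nat.cast_zero, add_zero] at this ⊢
    rw [this, convDen_self, convDen_pred]
    simp [continuant]
  | 1 =>
    have h0 := convDen_add c ν 0 fun j h1 h2 => h j h1 (by push_cast at h2 ⊢; omega)
    have h1 := convDen_add c ν 1 fun j h1 h2 => h j h1 (by push_cast at h2 ⊢; omega)
    simp only [Nat.cast_zero, add_zero, Nat.cast_one] at h0 h1 ⊢
    rw [h1, h0, add_sub_cancel_right, convDen_self, show ν + 1 + 1 = ν + 2 by ring]
    simp [continuant]
  | k + 2 =>
    have h0 := convDen_add c ν k fun j h1 h2 => h j h1 (by push_cast at h2 ⊢; omega)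
    have h1 := convDen_add c ν (k + 1) fun j h1 h2 => h j h1 (by push_cast at h2 ⊢; omega)
    have h2 := convDen_add c ν (k + 2) fun j h1 h2 => h j h1 (by push_cast at h2 ⊢; omega)
    rw [continuant_succ_succ, ← h0, ← h1] at h2
    push_cast at h2 ⊢
    ring_nf at h2 ⊢
    exact h2

theorem extD_eq_convNum (c : ℤ → ℤ) {ν ρ : ℤ} (h : ν + 1 < ρ) :
    extD c ν ρ = convNum c ν (ρ - 1) := by
  rw [extD, convNum, if_neg (by omega), if_neg (by omega)]

theorem extM_eq_convDen (c : ℤ → ℤ) {ν ρ : ℤ} (h : ν + 1 < ρ) :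
    extM c ν ρ = convDen c ν (ρ - 1) := by
  rw [extM, convDen, if_neg (by omega), if_neg (by omega)]

/-! ### Three-term recurrences -/

/-- `u_{i+1} = c_i u_i - u_{i-1}` for `s < i < t`. -/
def SatisfiesRec (c u : ℤ → ℤ) (s t : ℤ) : Prop :=
  ∀ i, s < i → i < t → u (i + 1) = c i * u i - u (i - 1)

namespace SatisfiesRec

variable {c u v : ℤ → ℤ} {s t : ℤ}

/-- Each step of the recurrence acts by a matrix of determinant one, so the Wronskian of two
solutions is constant. -/
theorem mul_sub_mul (hu : SatisfiesRec c u s t) (hv : SatisfiesRec c v s t) {i : ℤ} (hi : s ≤ i) :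
    i < t → u i * v (i + 1) - u (i + 1) * v i = u s * v (s + 1) - u (s + 1) * v s := by
  induction i, hi using Int.leInduction with
  | base => intro _; rfl
  | succ i hi ih =>
    intro h
    rw [← ih (by omega), hu (i + 1) (by omega) h, hv (i + 1) (by omega) h, add_sub_cancel_right]
    ring

theorem eq_of_eq (hu : SatisfiesRec c u s t) (hv : SatisfiesRec c v s t) (h0 : u s = v s)
    (h1 : u (s + 1) = v (s + 1)) {i : ℤ} (hi : s ≤ i) :
    i < t → u i = v i ∧ u (i + 1) = v (i + 1) := by
  induction i, hi using Int.leInduction with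
  | base => intro _; exact ⟨h0, h1⟩
  | succ i hi ih =>
    intro h
    obtain ⟨e0, e1⟩ := ih (by omega)
    refine ⟨e1, ?_⟩
    rw [hu (i + 1) (by omega) h, hv (i + 1) (by omega) h, add_sub_cancel_right, e0, e1]

theorem isCoprime (hu : SatisfiesRec c u s t) (h : IsCoprime (u s) (u (s + 1))) {i : ℤ}
    (hi : s ≤ i) : i < t → IsCoprime (u i) (u (i + 1)) := by
  induction i, hi using Int.leInduction with
  | base => intro _; exact h
  | succ i hi ih =>
    intro h
    obtain ⟨p, q, e⟩ := ih (by omega)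
    refine ⟨p * c (i + 1) + q, -p, ?_⟩
    rw [hu (i + 1) (by omega) h, add_sub_cancel_right]
    linear_combination e

theorem nonneg_lt (hc : ∀ i, s < i → i < t → 2 ≤ c i) (hu : SatisfiesRec c u s t)
    (h0 : 0 ≤ u s) (h1 : u s < u (s + 1)) {i : ℤ} (hi : s ≤ i) :
    i < t → 0 ≤ u i ∧ u i < u (i + 1) := by
  induction i, hi using Int.leInduction with
  | base => intro _; exact ⟨h0, h1⟩
  | succ i hi ih =>
    intro h
    obtain ⟨e0, e1⟩ := ih (by omega)
    have := hc (i + 1) (by omega) h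
    refine ⟨by omega, ?_⟩
    rw [hu (i + 1) (by omega) h, add_sub_cancel_right]
    nlinarith

theorem lt_of_lt (hc : ∀ i, s < i → i < t → 2 ≤ c i) (hu : SatisfiesRec c u s t)
    (h0 : 0 ≤ u s) (h1 : u s < u (s + 1)) {i j : ℤ} (hi : s ≤ i) (hij : i + 1 ≤ j) :
    j ≤ t → u i < u j := by
  induction j, hij using Int.leInduction with
  | base => intro h; exact (nonneg_lt hc hu h0 h1 hi (by omega)).2
  | succ j hj ih =>
    intro h
    exact (ih (by omega)).trans (nonneg_lt hc hu h0 h1 (by omega) (by omega)).2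

/-- The recurrence is symmetric under reversal of the index; this turns growth of `y` from the left
end into decay of `x` towards the right end. -/
theorem neg (hu : SatisfiesRec c u s t) :
    SatisfiesRec (fun i => c (-i)) (fun i => u (-i)) (-t) (-s) := by
  intro i h1 h2
  have := hu (-i) (by omega) (by omega)
  simp only [neg_add_rev, neg_sub]
  rw [show -1 + -i = -i - 1 by ring, show 1 - i = -i + 1 by ring, this]
  ring

theorem linear (hu : SatisfiesRec c u s t) (hv : SatisfiesRec c v s t) (p q : ℤ) :
    SatisfiesRec c (fun i => p * u i + q * v i) s t := by
  intro i h1 h2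
  simp only [hu i h1 h2, hv i h1 h2]
  ring

end SatisfiesRec

theorem IsCoeffSeq.satisfiesRec {c n : ℤ → ℤ} {s t : ℤ} (h : IsCoeffSeq c n s t) :
    SatisfiesRec c n s t := fun i h1 h2 => (h i h1 h2).2

/-! ### The lattice chain in the quadrant -/

/-- The vectors `(x_i, y_i)`, `ν ≤ i ≤ ρ`, lead from `(d, 0)` to `(0, d)` by unimodular steps of the
lattice `{(X, Y) : d ∣ a X + b Y}`, and `n_i` is the value of `(a X + b Y) / d` at `(x_i, y_i)`. -/
structure IsLatticeChain (a b d ν ρ : ℤ) (c x y n : ℤ → ℤ) : Prop where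
  lt : ν + 1 < ρ
  a_pos : 0 < a
  b_pos : 0 < b
  d_pos : 0 < d
  two_le : ∀ i, ν < i → i < ρ → 2 ≤ c i
  recX : SatisfiesRec c x ν ρ
  recY : SatisfiesRec c y ν ρ
  x_left : x ν = d
  y_left : y ν = 0
  y_left_succ : y (ν + 1) = 1
  x_right : x ρ = 0
  x_right_pred : x (ρ - 1) = 1
  y_right : y ρ = d
  value : ∀ i, ν ≤ i → i ≤ ρ → d * n i = a * x i + b * y i

namespace IsLatticeChain

variable {a b d ν ρ : ℤ} {c x y n : ℤ → ℤ}

theorem det (h : IsLatticeChain a b d ν ρ c x y n) {i : ℤ} (h1 : ν ≤ i) (h2 : i < ρ) :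
    x i * y (i + 1) - x (i + 1) * y i = d := by
  rw [h.recX.mul_sub_mul h.recY h1 h2, h.x_left, h.y_left, h.y_left_succ]
  ring

theorem y_lt (h : IsLatticeChain a b d ν ρ c x y n) {i j : ℤ} (h1 : ν ≤ i) (h2 : i < j)
    (h3 : j ≤ ρ) : y i < y j :=
  h.recY.lt_of_lt h.two_le h.y_left.ge (by rw [h.y_left, h.y_left_succ]; norm_num) h1 h2 h3

theorem x_lt (h : IsLatticeChain a b d ν ρ c x y n) {i j : ℤ} (h1 : ν ≤ i) (h2 : i < j)
    (h3 : j ≤ ρ) : x j < x i := by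
  have := h.recX.neg.lt_of_lt (i := -j) (j := -i) (fun i h1 h2 => h.two_le _ (by omega) (by omega))
    (by simp [h.x_right]) (by
      rw [show -(-ρ + 1) = ρ - 1 by ring, neg_neg, h.x_right, h.x_right_pred]; norm_num)
    (by omega) (by omega) (by omega)
  simpa using this

theorem y_le (h : IsLatticeChain a b d ν ρ c x y n) {i j : ℤ} (h1 : ν ≤ i) (h2 : i ≤ j)
    (h3 : j ≤ ρ) : y i ≤ y j := by
  rcases h2.eq_or_lt with rfl | h2
  · rfl
  · exact (h.y_lt h1 h2 h3).le

theorem x_le (h : IsLatticeChain a b d ν ρ c x y n) {i j : ℤ} (h1 : ν ≤ i) (h2 : i ≤ j)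
    (h3 : j ≤ ρ) : x j ≤ x i := by
  rcases h2.eq_or_lt with rfl | h2
  · rfl
  · exact (h.x_lt h1 h2 h3).le

theorem lt_of_y_lt (h : IsLatticeChain a b d ν ρ c x y n) {i j : ℤ} (h1 : ν ≤ j) (h3 : i ≤ ρ)
    (hy : y i < y j) : i < j := by
  by_contra hij
  exact absurd (h.y_le h1 (not_lt.1 hij) h3) (not_le.2 hy)

theorem lt_of_x_lt (h : IsLatticeChain a b d ν ρ c x y n) {i j : ℤ} (h1 : ν ≤ j) (h3 : i ≤ ρ)
    (hx : x j < x i) : i < j := by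
  by_contra hij
  exact absurd (h.x_le h1 (not_lt.1 hij) h3) (not_le.2 hx)

theorem y_nonneg (h : IsLatticeChain a b d ν ρ c x y n) {i : ℤ} (h1 : ν ≤ i) (h2 : i ≤ ρ) :
    0 ≤ y i := h.y_left ▸ h.y_le le_rfl h1 h2

theorem x_nonneg (h : IsLatticeChain a b d ν ρ c x y n) {i : ℤ} (h1 : ν ≤ i) (h2 : i ≤ ρ) :
    0 ≤ x i := h.x_right ▸ h.x_le h1 h2 le_rfl

theorem n_pos (h : IsLatticeChain a b d ν ρ c x y n) {i : ℤ} (h1 : ν ≤ i) (h2 : i ≤ ρ) :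
    0 < n i := by
  have hx := h.x_nonneg h1 h2
  have hy := h.y_nonneg h1 h2
  have hv := h.value i h1 h2
  have ha := h.a_pos
  have hb := h.b_pos
  refine pos_of_mul_pos_right (a := d) ?_ h.d_pos.le
  rw [hv]
  rcases h1.eq_or_lt with rfl | h1
  · rw [h.x_left, h.y_left]
    have := mul_pos ha h.d_pos
    omega
  · have h3 : 0 < y i := h.y_left ▸ h.y_lt le_rfl h1 h2
    have := mul_pos hb h3
    have := mul_nonneg ha.le hx
    omega

/-- A point of the lattice in the quadrant is a combination of two consecutive members of the
chain. -/
theorem exists_combination (h : IsLatticeChain a b d ν ρ c x y n) (had : IsCoprime a d)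
    {X Y s : ℤ} (hX : 0 ≤ X) (hY : 0 ≤ Y) (hs : d * s = a * X + b * Y) :
    ∃ j α β, ν ≤ j ∧ j < ρ ∧ 0 ≤ α ∧ 0 ≤ β ∧ X = α * x j + β * x (j + 1) ∧
      Y = α * y j + β * y (j + 1) ∧ s = α * n j + β * n (j + 1) := by
  have hd := h.d_pos
  have hlt := h.lt
  -- The sign of the determinant tells on which side of the ray through `(x_j, y_j)` the point lies;
  -- the last admissible `j` gives the cone containing it.
  obtain ⟨j, ⟨h1, h2, h3⟩, h4⟩ := Int.exists_greatest_of_bdd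
    (P := fun j => ν ≤ j ∧ j < ρ ∧ 0 ≤ x j * Y - y j * X) ⟨ρ, fun z hz => hz.2.1.le⟩
    ⟨ν, le_rfl, by omega, by rw [h.x_left, h.y_left]; nlinarith⟩
  have h5 : 0 ≤ X * y (j + 1) - Y * x (j + 1) := by
    rcases (show j + 1 ≤ ρ by omega).eq_or_lt with e | e
    · rw [e, h.x_right, h.y_right]; nlinarith
    · by_contra hneg
      have := h4 (j + 1) ⟨by omega, e, by nlinarith⟩
      omega
  -- The coordinates given by Cramer's rule are integral: `a (X y_i - Y x_i) = d (s y_i - Y n_i)`,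
  -- and `a` is prime to `d`.
  have dvd : ∀ i, ν ≤ i → i ≤ ρ → d ∣ X * y i - Y * x i := by
    intro i hi hi'
    refine had.symm.dvd_of_dvd_mul_left ?_
    refine ⟨s * y i - Y * n i, ?_⟩
    linear_combination (-y i) * hs + Y * h.value i hi hi'
  obtain ⟨α, hα⟩ := dvd (j + 1) (by omega) (by omega)
  obtain ⟨β, hβ⟩ := dvd j h1 h2.le
  have hdet := h.det h1 h2
  have eX : X = α * x j + -β * x (j + 1) := by
    refine mul_left_cancel₀ hd.ne' ?_
    linear_combination (-X) * hdet + x j * hα - x (j + 1) * hβ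
  have eY : Y = α * y j + -β * y (j + 1) := by
    refine mul_left_cancel₀ hd.ne' ?_
    linear_combination (-Y) * hdet + y j * hα - y (j + 1) * hβ
  refine ⟨j, α, -β, h1, h2, ?_, ?_, eX, eY, ?_⟩
  · rw [hα] at h5
    exact nonneg_of_mul_nonneg_right h5 hd
  · refine nonneg_of_mul_nonneg_right (a := d) ?_ hd
    linarith
  · refine mul_left_cancel₀ hd.ne' ?_
    linear_combination hs + a * eX + b * eY - α * h.value j h1 h2.le
      + β * h.value (j + 1) (by omega) (by omega)

theorem exists_le_le (h : IsLatticeChain a b d ν ρ c x y n) (had : IsCoprime a d)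
    {X Y s : ℤ} (hX : 0 ≤ X) (hY : 0 ≤ Y) (hs : d * s = a * X + b * Y) (h0 : s ≠ 0) :
    ∃ j, ν ≤ j ∧ j ≤ ρ ∧ x j ≤ X ∧ y j ≤ Y := by
  obtain ⟨j, α, β, h1, h2, hα, hβ, eX, eY, es⟩ := h.exists_combination had hX hY hs
  have x0 := h.x_nonneg h1 h2.le
  have x1 := h.x_nonneg (show ν ≤ j + 1 by omega) (by omega)
  have y0 := h.y_nonneg h1 h2.le
  have y1 := h.y_nonneg (show ν ≤ j + 1 by omega) (by omega)
  rcases hα.eq_or_lt with rfl | hα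
  · rcases hβ.eq_or_lt with rfl | hβ
    · simp at es; exact absurd es h0
    · exact ⟨j + 1, by omega, by omega, by nlinarith, by nlinarith⟩
  · exact ⟨j, by omega, by omega, by nlinarith, by nlinarith⟩

/-- If every member of the chain below `(X, Y)` has its value in the submonoid, then so has
`(X, Y)`. -/
theorem mem_of_forall_le (h : IsLatticeChain a b d ν ρ c x y n) (had : IsCoprime a d)
    {X Y s : ℤ} (hX : 0 ≤ X) (hY : 0 ≤ Y) (hs : d * s = a * X + b * Y) (T : AddSubmonoid ℤ)
    (hT : ∀ j, ν ≤ j → j ≤ ρ → x j ≤ X → y j ≤ Y → n j ≤ s → n j ∈ T) : s ∈ T := by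
  obtain ⟨j, α, β, h1, h2, hα, hβ, eX, eY, es⟩ := h.exists_combination had hX hY hs
  have x0 := h.x_nonneg h1 h2.le
  have x1 := h.x_nonneg (show ν ≤ j + 1 by omega) (by omega)
  have y0 := h.y_nonneg h1 h2.le
  have y1 := h.y_nonneg (show ν ≤ j + 1 by omega) (by omega)
  have n0 := h.n_pos h1 h2.le
  have n1 := h.n_pos (show ν ≤ j + 1 by omega) (by omega)
  lift α to ℕ using hα
  lift β to ℕ using hβ
  rw [es, ← nsmul_eq_mul, ← nsmul_eq_mul]
  have px := mul_nonneg (Int.natCast_nonneg α) x0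
  have py := mul_nonneg (Int.natCast_nonneg α) y0
  have pn := mul_nonneg (Int.natCast_nonneg α) n0.le
  have qx := mul_nonneg (Int.natCast_nonneg β) x1
  have qy := mul_nonneg (Int.natCast_nonneg β) y1
  have qn := mul_nonneg (Int.natCast_nonneg β) n1.le
  refine T.add_mem ?_ ?_
  · rcases Nat.eq_zero_or_pos α with rfl | hα
    · simp
    · have : (1 : ℤ) ≤ α := by exact_mod_cast hα
      exact T.nsmul_mem (hT j h1 h2.le (by nlinarith) (by nlinarith) (by nlinarith)) _
  · rcases Nat.eq_zero_or_pos β with rfl | hβ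
    · simp
    · have : (1 : ℤ) ≤ β := by exact_mod_cast hβ
      exact T.nsmul_mem (hT (j + 1) (by omega) (by omega) (by nlinarith) (by nlinarith)
        (by nlinarith)) _

/-- If `a ≤ y_{t+1}` and `x_t + b ≤ x_{s-1}`, then all values of the chain are generated by those
at the indices from `s` to `t`. -/
theorem n_mem_closure (h : IsLatticeChain a b d ν ρ c x y n) (had : IsCoprime a d) {s t : ℤ}
    (hs : ν < s) (hst : s ≤ t) (ht : t < ρ) (hy : a ≤ y (t + 1)) (hx : x t + b ≤ x (s - 1))
    {i : ℤ} (hi : ν ≤ i) (hi' : i ≤ ρ) : n i ∈ AddSubmonoid.closure (n '' Set.Icc s t) := by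
  have ha := h.a_pos
  have hb := h.b_pos
  -- For `i > t`, the point `(x_i + b, y_i - a)` has the same value. A chain point `j` below it has
  -- `y_j < y_i` and `x_j < x_{s-1}`, hence `s ≤ j < i`.
  have up : ∀ k : ℕ, ∀ i, s ≤ i → i ≤ s + k → i ≤ ρ →
      n i ∈ AddSubmonoid.closure (n '' Set.Icc s t) := by
    intro k
    induction k with
    | zero =>
      intro i h1 h2 _
      exact AddSubmonoid.subset_closure ⟨i, ⟨h1, by push_cast at h2; omega⟩, rfl⟩
    | succ k ih =>
      intro i h1 h2 h3
      rcases le_or_gt i t with h4 | h4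
      · exact AddSubmonoid.subset_closure ⟨i, ⟨h1, h4⟩, rfl⟩
      have hyi := h.y_le (show ν ≤ t + 1 by omega) (show t + 1 ≤ i by omega) h3
      have hxi := h.x_lt (show ν ≤ t by omega) h4 h3
      have hx0 := h.x_nonneg (show ν ≤ i by omega) h3
      refine h.mem_of_forall_le had (X := x i + b) (Y := y i - a) (by omega) (by omega)
        (by rw [h.value i (by omega) h3]; ring) _ fun j j1 j2 jx jy _ => ?_
      have := h.lt_of_y_lt (i := j) (j := i) (by omega) j2 (by omega)
      have := h.lt_of_x_lt (i := s - 1) (j := j) j1 (by omega) (by omega)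
      exact ih j (by omega) (by push_cast at h2; omega) j2
  -- For `i < s`, the translate `(x_i - b, y_i + a)` stays in the quadrant, and the chain points
  -- below it have index greater than `i`.
  have down : ∀ k : ℕ, ∀ i, ν ≤ i → s - k ≤ i → i ≤ ρ →
      n i ∈ AddSubmonoid.closure (n '' Set.Icc s t) := by
    intro k
    induction k with
    | zero =>
      intro i h1 h2 h3
      exact up (i - s).toNat i (by push_cast at h2; omega) (by omega) h3
    | succ k ih =>
      intro i h1 h2 h3
      rcases le_or_gt s i with h4 | h4
      · exact up (i - s).toNat i h4 (by omega) h3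
      have hxi := h.x_le h1 (show i ≤ s - 1 by omega) (by omega)
      have hyi := h.y_nonneg h1 h3
      have hxt := h.x_nonneg (show ν ≤ t by omega) ht.le
      refine h.mem_of_forall_le had (X := x i - b) (Y := y i + a) (by omega) (by omega)
        (by rw [h.value i h1 h3]; ring) _ fun j j1 j2 jx jy _ => ?_
      have := h.lt_of_x_lt (i := i) (j := j) j1 h3 (by omega)
      exact ih j j1 (by push_cast at h2; omega) j2
  exact down (s - i).toNat i hi (by omega) hi'

/-- The member `(x_i, y_i)` of the chain is not a sum of two points of the lattice in the quadrant
with nonzero values. -/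
theorem not_add (h : IsLatticeChain a b d ν ρ c x y n) (had : IsCoprime a d) {i : ℤ} (hi : ν ≤ i)
    (hi' : i ≤ ρ) {X Y s X' Y' s' : ℤ} (hX : 0 ≤ X) (hY : 0 ≤ Y) (hX' : 0 ≤ X') (hY' : 0 ≤ Y')
    (hs : d * s = a * X + b * Y) (hs' : d * s' = a * X' + b * Y') (h0 : s ≠ 0) (h0' : s' ≠ 0)
    (ex : X + X' = x i) (ey : Y + Y' = y i) : False := by
  obtain ⟨j, j1, j2, jx, jy⟩ := h.exists_le_le had hX hY hs h0
  obtain ⟨k, k1, k2, kx, ky⟩ := h.exists_le_le had hX' hY' hs' h0'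
  -- The chain is an antichain, so both summands dominate `(x_i, y_i)` itself, which forces a
  -- summand to vanish.
  have key : ∀ j, ν ≤ j → j ≤ ρ → x j ≤ x i → y j ≤ y i → j = i := by
    intro j j1 j2 jx jy
    rcases lt_trichotomy j i with e | e | e
    · have := h.x_lt j1 e hi'
      omega
    · exact e
    · have := h.y_lt hi e j2
      omega
  obtain rfl := key j j1 j2 (by omega) (by omega)
  obtain rfl := key k k1 k2 (by omega) (by omega)
  have e1 : Y = 0 ∧ Y' = 0 ∧ X = 0 := by omega
  rw [e1.1, e1.2.2] at hs
  have : d * s = 0 := by linarith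
  rcases mul_eq_zero.1 this with h1 | h1
  · exact h.d_pos.ne' h1
  · exact h0 h1

end IsLatticeChain

/-! ### The chain attached to a coefficient sequence -/

theorem satisfiesRec_convNum {c : ℤ → ℤ} {ν ρ : ℤ} (two : ∀ i, ν < i → i < ρ → 2 ≤ c i) :
    SatisfiesRec c (fun i => convNum c ν (i - 1)) ν ρ := by
  intro i h1 h2
  have := convNum_succ c ν (i - 1) (by omega) fun j h3 h4 => two j h3 (by omega)
  simp only [sub_add_cancel, add_sub_cancel_right] at this ⊢
  exact this

theorem satisfiesRec_convDen {c : ℤ → ℤ} {ν ρ : ℤ} (two : ∀ i, ν < i → i < ρ → 2 ≤ c i) :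
    SatisfiesRec c (fun i => convDen c ν (i - 1)) ν ρ := by
  intro i h1 h2
  have := convDen_succ c ν (i - 1) (by omega) fun j h3 h4 => two j h3 (by omega)
  simp only [sub_add_cancel, add_sub_cancel_right] at this ⊢
  exact this

theorem satisfiesRec_extX {c : ℤ → ℤ} {ν ρ : ℤ} (two : ∀ i, ν < i → i < ρ → 2 ≤ c i) :
    SatisfiesRec c (extX c ν ρ) ν ρ := by
  intro i h1 h2
  have := (satisfiesRec_convNum two).linear (satisfiesRec_convDen two) (extM c ν ρ)
    (-extD c ν ρ) i h1 h2
  simp only [extX] at this ⊢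
  linear_combination this

theorem extX_left (c : ℤ → ℤ) (ν ρ : ℤ) : extX c ν ρ ν = extD c ν ρ := by
  rw [extX, convNum_pred, convDen_pred]; ring

theorem extX_left_succ (c : ℤ → ℤ) (ν ρ : ℤ) : extX c ν ρ (ν + 1) = extM c ν ρ := by
  rw [extX, add_sub_cancel_right, convNum_self, convDen_self]; ring

theorem extX_right (c : ℤ → ℤ) {ν ρ : ℤ} (h : ν + 1 < ρ) : extX c ν ρ ρ = 0 := by
  rw [extX, extD_eq_convNum c h, extM_eq_convDen c h]; ring

theorem extX_right_pred {c : ℤ → ℤ} {ν ρ : ℤ} (h : ν + 1 < ρ)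
    (two : ∀ i, ν < i → i < ρ → 2 ≤ c i) : extX c ν ρ (ρ - 1) = 1 := by
  have := (satisfiesRec_convDen two).mul_sub_mul (satisfiesRec_convNum two)
    (show ν ≤ ρ - 1 by omega) (by omega)
  simp only [sub_add_cancel, add_sub_cancel_right, convNum_self, convNum_pred, convDen_pred] at this
  rw [extX, extD_eq_convNum c h, extM_eq_convDen c h]
  linear_combination -this

theorem extD_pos {c : ℤ → ℤ} {ν ρ : ℤ} (h : ν + 1 < ρ)
    (two : ∀ i, ν < i → i < ρ → 2 ≤ c i) : 0 < extD c ν ρ := by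
  have := ((satisfiesRec_convNum two).nonneg_lt two (convNum_pred c ν).ge
    (by rw [add_sub_cancel_right, convNum_self, convNum_pred]; norm_num)
    (show ν ≤ ρ - 1 by omega) (by omega))
  rw [extD_eq_convNum c h]
  simp only [sub_add_cancel] at this
  omega

namespace IsCoeffSeq

variable {n c : ℤ → ℤ} {ν ρ : ℤ}

/-- Both sides solve the same recurrence. They agree at `ν`, and at `ν + 1` the equality is the
definition of `b`. -/
theorem extD_mul (h : IsCoeffSeq c n ν ρ) (hlt : ν + 1 < ρ) (i : ℤ) (h1 : ν ≤ i) (h2 : i ≤ ρ) :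
    extD c ν ρ * n i = n ν * extX c ν ρ i + extB n c ν ρ * convNum c ν (i - 1) := by
  have two : ∀ i, ν < i → i < ρ → 2 ≤ c i := fun i h1 h2 => (h i h1 h2).1
  have key {i : ℤ} := SatisfiesRec.eq_of_eq (i := i)
    ((h.satisfiesRec.linear h.satisfiesRec (extD c ν ρ) 0))
    ((satisfiesRec_extX two).linear (satisfiesRec_convNum two) (n ν) (extB n c ν ρ))
    (by simp only [extX_left, convNum_pred]; ring)
    (by simp only [extX_left_succ, add_sub_cancel_right, convNum_self, extB]; ring)
  rcases h2.eq_or_lt with rfl | h2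
  · have := (key (show ν ≤ i - 1 by omega) (by omega)).2
    simp only [sub_add_cancel] at this
    linear_combination this
  · have := (key h1 h2).1
    linear_combination this

theorem right_eq_extB (h : IsCoeffSeq c n ν ρ) (hlt : ν + 1 < ρ) : n ρ = extB n c ν ρ := by
  have h1 := h.extD_mul hlt ρ (by omega) le_rfl
  rw [extX_right c hlt, ← extD_eq_convNum c hlt] at h1
  exact mul_left_cancel₀ (extD_pos hlt fun i h1 h2 => (h i h1 h2).1).ne' (by linear_combination h1)

/-- The chain attached to a sequence with coefficients at least `2`. -/
theorem isLatticeChain (h : IsCoeffSeq c n ν ρ) (hlt : ν + 1 < ρ) (ha : 0 < n ν)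
    (hb : 0 < extB n c ν ρ) :
    IsLatticeChain (n ν) (extB n c ν ρ) (extD c ν ρ) ν ρ c (extX c ν ρ)
      (fun i => convNum c ν (i - 1)) n := by
  have two : ∀ i, ν < i → i < ρ → 2 ≤ c i := fun i h1 h2 => (h i h1 h2).1
  exact ⟨hlt, ha, hb, extD_pos hlt two, two, satisfiesRec_extX two, satisfiesRec_convNum two,
    extX_left c ν ρ, convNum_pred c ν, by rw [add_sub_cancel_right, convNum_self],
    extX_right c hlt, extX_right_pred hlt two, (extD_eq_convNum c hlt).symm, h.extD_mul hlt⟩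

end IsCoeffSeq

/-! ### Quotients, generators and irreducible elements -/

theorem mem_semigroupQuot_pair {a b d s : ℕ} :
    s ∈ semigroupQuot (AddSubmonoid.closure {a, b}) d ↔ ∃ X Y : ℕ, d * s = a * X + b * Y := by
  rw [semigroupQuot, AddSubmonoid.mem_comap, AddSubmonoid.mem_closure_pair]
  simp only [smul_eq_mul, AddMonoidHom.coe_mulLeft]
  constructor
  · rintro ⟨X, Y, h⟩
    exact ⟨X, Y, by rw [← h]; ring⟩
  · rintro ⟨X, Y, h⟩
    exact ⟨X, Y, by rw [h]; ring⟩

theorem natCast_mem_closure {A : Set ℕ} {k : ℕ} :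
    (k : ℤ) ∈ AddSubmonoid.closure ((fun k : ℕ => (k : ℤ)) '' A) ↔ k ∈ AddSubmonoid.closure A := by
  have := AddMonoidHom.map_mclosure (Nat.castAddMonoidHom ℤ) A
  rw [Nat.coe_castAddMonoidHom] at this
  rw [← this, AddSubmonoid.mem_map]
  constructor
  · rintro ⟨l, hl, e⟩
    rw [Nat.coe_castAddMonoidHom, Nat.cast_inj] at e
    exact e ▸ hl
  · intro h
    exact ⟨k, h, rfl⟩

/-- A sum of natural numbers that is smaller than `i` cannot involve `i`. Hence a decomposition of
`i` into smaller positive elements would contradict independence. -/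
theorem mem_closure_diff_of_lt {A : Set ℕ} {u i : ℕ} (hu : u ∈ AddSubmonoid.closure A) :
    u < i → u ∈ AddSubmonoid.closure (A \ {i}) := by
  induction hu using AddSubmonoid.closure_induction with
  | mem x hx =>
    intro h
    exact AddSubmonoid.subset_closure ⟨hx, h.ne⟩
  | zero => intro _; exact AddSubmonoid.zero_mem _
  | add x y _ _ hx hy =>
    intro h
    exact AddSubmonoid.add_mem _ (hx (by omega)) (hy (by omega))

theorem irr_closure_subset (A : Set ℕ) : irr (AddSubmonoid.closure A) ⊆ A := by
  rintro s ⟨hs, hs0, hirr⟩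
  have key : s = 0 ∨ s ∈ A ∨ ∃ u ∈ AddSubmonoid.closure A, ∃ v ∈ AddSubmonoid.closure A,
      0 < u ∧ 0 < v ∧ s = u + v := by
    clear hs0 hirr
    induction hs using AddSubmonoid.closure_induction with
    | mem x hx => exact Or.inr (Or.inl hx)
    | zero => exact Or.inl rfl
    | add x y hx hy ihx ihy =>
      rcases Nat.eq_zero_or_pos x with rfl | hx0
      · simpa using ihy
      rcases Nat.eq_zero_or_pos y with rfl | hy0
      · simpa using ihx
      exact Or.inr (Or.inr ⟨x, hx, y, hy, hx0, hy0, rfl⟩)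
  rcases key with h | h | ⟨u, hu, v, hv, hu0, hv0, e⟩
  · omega
  · exact h
  · exact absurd e (hirr u hu v hv hu0 hv0)

theorem NIndependent.irr_closure {A : Set ℕ} (hA : NIndependent A) (h0 : 0 ∉ A) :
    irr (AddSubmonoid.closure A) = A := by
  refine (irr_closure_subset A).antisymm fun i hi => ⟨AddSubmonoid.subset_closure hi,
    Nat.pos_of_ne_zero fun h => h0 (h ▸ hi), fun u hu v hv hu0 hv0 e => hA i hi ?_⟩
  have h1 := mem_closure_diff_of_lt (i := i) hu (by omega)
  have h2 := mem_closure_diff_of_lt (i := i) hv (by omega)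
  have := AddSubmonoid.add_mem _ h1 h2
  rwa [← e] at this

/-! ### Irreducible elements as an interval of the chain -/

namespace IsLatticeChain

variable {a b d : ℕ} {ν ρ : ℤ} {c x y n : ℤ → ℤ}

theorem mem_semigroupQuot (h : IsLatticeChain a b d ν ρ c x y n) {i : ℤ} (h1 : ν ≤ i) (h2 : i ≤ ρ)
    {k : ℕ} (hk : (k : ℤ) = n i) : k ∈ semigroupQuot (AddSubmonoid.closure {a, b}) d := by
  obtain ⟨X, hX⟩ := Int.eq_ofNat_of_zero_le (h.x_nonneg h1 h2)
  obtain ⟨Y, hY⟩ := Int.eq_ofNat_of_zero_le (h.y_nonneg h1 h2)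
  have hv := h.value i h1 h2
  rw [← hk, hX, hY] at hv
  exact mem_semigroupQuot_pair.2 ⟨X, Y, by exact_mod_cast hv⟩

theorem semigroupQuot_eq (h : IsLatticeChain a b d ν ρ c x y n) (had : Nat.Coprime a d) {s t : ℤ}
    (hs : ν < s) (hst : s ≤ t) (ht : t < ρ) (hy : a ≤ y (t + 1)) (hx : x t + b ≤ x (s - 1))
    {A : Set ℕ} (hA : n '' Set.Icc s t = (fun k : ℕ => (k : ℤ)) '' A) :
    semigroupQuot (AddSubmonoid.closure {a, b}) d = AddSubmonoid.closure A := by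
  refine le_antisymm (fun k hk => ?_) (AddSubmonoid.closure_le.2 fun k hk => ?_)
  · obtain ⟨X, Y, e⟩ := mem_semigroupQuot_pair.1 hk
    rw [← natCast_mem_closure, ← hA]
    exact h.mem_of_forall_le had.isCoprime (Int.natCast_nonneg X) (Int.natCast_nonneg Y)
      (by exact_mod_cast e) _ fun j h1 h2 _ _ _ =>
        h.n_mem_closure had.isCoprime hs hst ht hy hx h1 h2
  · have : (k : ℤ) ∈ n '' Set.Icc s t := hA ▸ ⟨k, hk, rfl⟩
    obtain ⟨i, hi, e⟩ := this
    exact h.mem_semigroupQuot (hs.le.trans hi.1) (hi.2.trans ht.le) e.symm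

/-- Translation by multiples of `(b, -a)` brings `Y` into `(0, a]`. If `Y = 0`, then `d ∣ X`, so `X
≥ d > b` leaves room for the opposite translation. -/
theorem exists_reduced (h : IsLatticeChain a b d ν ρ c x y n) (had : Nat.Coprime a d) (hbd : b < d)
    {u : ℕ} (hu : u ∈ semigroupQuot (AddSubmonoid.closure {a, b}) d) (hu0 : 0 < u) :
    ∃ X Y : ℤ, 0 ≤ X ∧ 0 < Y ∧ Y ≤ a ∧ (d : ℤ) * u = a * X + b * Y := by
  obtain ⟨X, Y, e⟩ := mem_semigroupQuot_pair.1 hu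
  have ha := h.a_pos
  have hb := h.b_pos
  have e' : (d : ℤ) * u = a * X + b * Y := by exact_mod_cast e
  rcases Nat.eq_zero_or_pos Y with rfl | hY
  · have hdX : d ∣ X := had.symm.dvd_of_dvd_mul_left ⟨u, by rw [e]; ring⟩
    have hX0 : 0 < X := by
      rcases Nat.eq_zero_or_pos X with rfl | hX
      · have := Nat.mul_pos (show 0 < d by omega) hu0
        omega
      · exact hX
    have := Nat.le_of_dvd hX0 hdX
    exact ⟨X - b, a, by omega, ha, le_rfl, by push_cast at e'; linear_combination e'⟩
  · have h1 := Int.emod_nonneg ((Y : ℤ) - 1) ha.ne'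
    have h2 := Int.emod_lt_of_pos ((Y : ℤ) - 1) ha
    have h3 := Int.mul_ediv_add_emod ((Y : ℤ) - 1) a
    have h4 : 0 ≤ ((Y : ℤ) - 1) / a := Int.ediv_nonneg (by omega) ha.le
    refine ⟨X + b * (((Y : ℤ) - 1) / a), Y - a * (((Y : ℤ) - 1) / a), ?_, by omega, by omega, ?_⟩
    · have := mul_nonneg hb.le h4
      omega
    · linear_combination e'

/-- In a decomposition, reduced representations of the summands add up to `(x_i, y_i) + q (-b, a)`,
and the bounds on the second coordinates leave only `q = 0` and `q = 1`. The former contradicts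
`not_add`, the latter the choice of `t`. -/
theorem mem_irr (h : IsLatticeChain a b d ν ρ c x y n) (had : Nat.Coprime a d)
    (hab : Nat.Coprime a b) (hbd : b < d) {t i : ℤ} (ht : t < ρ) (hyt : y t ≤ a)
    (hyt' : a < y (t + 1)) (hi : ν < i) (hit : i ≤ t) (hx : x i < x t + b) {k : ℕ}
    (hk : (k : ℤ) = n i) : k ∈ irr (semigroupQuot (AddSubmonoid.closure {a, b}) d) := by
  have ha := h.a_pos
  have hn := h.n_pos hi.le (hit.trans ht.le)
  refine ⟨h.mem_semigroupQuot hi.le (hit.trans ht.le) hk, by omega, fun u hu w hw hu0 hw0 e => ?_⟩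
  obtain ⟨X, Y, hX, hY, hYa, eu⟩ := h.exists_reduced had hbd hu hu0
  obtain ⟨X', Y', hX', hY', hYa', ew⟩ := h.exists_reduced had hbd hw hw0
  have hv := h.value i hi.le (hit.trans ht.le)
  have hy0 : 0 < y i := h.y_left ▸ h.y_lt le_rfl hi (hit.trans ht.le)
  have hya : y i ≤ a := (h.y_le hi.le hit ht.le).trans hyt
  rw [← hk, e] at hv
  push_cast at hv
  have hdvd : (a : ℤ) ∣ Y + Y' - y i := by
    refine hab.isCoprime.dvd_of_dvd_mul_left ⟨x i - X - X', ?_⟩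
    linear_combination -eu - ew + hv
  obtain ⟨q, hq⟩ := hdvd
  have hq1 : -1 < q := by nlinarith
  have hq2 : q < 2 := by nlinarith
  have hXX : X + X' - x i = -b * q := by
    refine mul_left_cancel₀ ha.ne' ?_
    linear_combination hv - eu - ew - (b : ℤ) * hq
  have hq3 : q = 0 ∨ q = 1 := by omega
  rcases hq3 with rfl | rfl
  · exact h.not_add had.isCoprime hi.le (hit.trans ht.le) hX hY.le hX' hY'.le eu ew (by omega)
      (by omega) (by linarith) (by linarith)
  -- Here `X ≤ x_i - b < x_t`, so a chain point below `(X, Y)` lies beyond `t` and has `y_j > a ≥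
  -- Y`.
  · obtain ⟨j, j1, j2, jx, jy⟩ := h.exists_le_le had.isCoprime hX hY.le eu (by omega)
    have := h.lt_of_x_lt (i := t) (j := j) j1 ht.le (by linarith)
    have := h.y_le (show ν ≤ t + 1 by omega) (show t + 1 ≤ j by omega) j2
    omega

/-- The value determines `y_i` modulo `a`, and `0 < y_i ≤ a` on this range. -/
theorem eq_of_n_eq (h : IsLatticeChain a b d ν ρ c x y n) (hab : Nat.Coprime a b) {t i j : ℤ}
    (ht : t < ρ) (hyt : y t ≤ a) (hi : ν < i) (hit : i ≤ t) (hj : ν < j) (hjt : j ≤ t)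
    (hij : n i = n j) : i = j := by
  have hvi := h.value i hi.le (hit.trans ht.le)
  have hvj := h.value j hj.le (hjt.trans ht.le)
  have hyi : 0 < y i := h.y_left ▸ h.y_lt le_rfl hi (hit.trans ht.le)
  have hyj : 0 < y j := h.y_left ▸ h.y_lt le_rfl hj (hjt.trans ht.le)
  have hyi' : y i ≤ a := (h.y_le hi.le hit ht.le).trans hyt
  have hyj' : y j ≤ a := (h.y_le hj.le hjt ht.le).trans hyt
  have hdvd : (a : ℤ) ∣ y i - y j := by
    refine hab.isCoprime.dvd_of_dvd_mul_left ⟨x j - x i, ?_⟩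
    rw [hij] at hvi
    linear_combination hvj - hvi
  have h0 := Int.eq_zero_of_abs_lt_dvd hdvd (by rw [abs_lt]; constructor <;> omega)
  rcases lt_trichotomy i j with e | e | e
  · have := h.y_lt hi.le e (hjt.trans ht.le)
    omega
  · exact e
  · have := h.y_lt hj.le e (hit.trans ht.le)
    omega

/-- The irreducible elements are the values of the chain at the indices of an interval, without
repetitions. -/
theorem exists_bijOn_irr (h : IsLatticeChain a b d ν ρ c x y n) (had : Nat.Coprime a d)
    (hab : Nat.Coprime a b) (hlt : a < b) (hbd : b < d) :
    ∃ s t : ℤ, ν < s ∧ s ≤ t ∧ t < ρ ∧ a ≤ y (t + 1) ∧ x s < x t + b ∧ x t + b ≤ x (s - 1) ∧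
      Set.BijOn n (Set.Icc s t)
        ((fun k : ℕ => (k : ℤ)) '' irr (semigroupQuot (AddSubmonoid.closure {a, b}) d)) := by
  have ha := h.a_pos
  have hb := h.b_pos
  have hνρ := h.lt
  obtain ⟨t, ⟨h1, h2, h3⟩, h4⟩ := Int.exists_greatest_of_bdd
    (P := fun t => ν < t ∧ t < ρ ∧ y t ≤ a) ⟨ρ, fun z hz => hz.2.1.le⟩
    ⟨ν + 1, by omega, hνρ, by rw [h.y_left_succ]; omega⟩
  have h5 : a < y (t + 1) := by
    rcases (show t + 1 ≤ ρ by omega).eq_or_lt with e | e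
    · rw [e, h.y_right]; omega
    · by_contra hneg
      have := h4 (t + 1) ⟨by omega, e, by omega⟩
      omega
  obtain ⟨s, ⟨h6, h7, h8⟩, h9⟩ := Int.exists_least_of_bdd
    (P := fun s => ν ≤ s ∧ s ≤ ρ ∧ x s < x t + b) ⟨ν, fun z hz => hz.1⟩
    ⟨t, h1.le, h2.le, by omega⟩
  have hst : s ≤ t := h9 t ⟨h1.le, h2.le, by omega⟩
  have hs : ν < s := by
    rcases h6.eq_or_lt with rfl | hs
    · rw [h.x_left] at h8
      -- The point `(d - b, a)` is the translate of `(d, 0)`. If `d < x_t + b`, a chain point below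
      -- it would lie beyond `t`, where `y > a`.
      obtain ⟨j, j1, j2, jx, jy⟩ := h.exists_le_le had.isCoprime (X := (d : ℤ) - b) (Y := a)
        (s := a) (by omega) ha.le (by ring) ha.ne'
      have := h.lt_of_x_lt (i := t) (j := j) j1 h2.le (by omega)
      have := h.y_le (show ν ≤ t + 1 by omega) (show t + 1 ≤ j by omega) j2
      omega
    · exact hs
  have hxs : x t + b ≤ x (s - 1) := by
    by_contra hneg
    have := h9 (s - 1) ⟨by omega, by omega, by omega⟩
    omega
  have hmem : ∀ i ∈ Set.Icc s t, ∃ k : ℕ, (k : ℤ) = n i ∧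
      k ∈ irr (semigroupQuot (AddSubmonoid.closure {a, b}) d) := by
    rintro i ⟨hi, hi'⟩
    obtain ⟨k, hk⟩ := Int.eq_ofNat_of_zero_le (h.n_pos (i := i) (by omega) (by omega)).le
    refine ⟨k, hk.symm, h.mem_irr had hab hbd h2 h3 h5 (by omega) hi' ?_ hk.symm⟩
    exact (h.x_le hs.le hi (by omega)).trans_lt h8
  refine ⟨s, t, hs, hst, h2, h5.le, h8, hxs, fun i hi => ?_, fun i hi j hj e => ?_, ?_⟩
  · obtain ⟨k, hk, hk'⟩ := hmem i hi
    exact ⟨k, hk', hk⟩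
  · exact h.eq_of_n_eq hab h2 h3 (by have := hi.1; omega) hi.2 (by have := hj.1; omega) hj.2 e
  · rintro _ ⟨k, hk, rfl⟩
    have hA : n '' Set.Icc s t = (fun k : ℕ => (k : ℤ)) '' {k : ℕ | (k : ℤ) ∈ n '' Set.Icc s t} := by
      ext z
      constructor
      · rintro ⟨i, hi, rfl⟩
        obtain ⟨k, hk, -⟩ := hmem i hi
        exact ⟨k, ⟨i, hi, hk.symm⟩, hk⟩
      · rintro ⟨k, hk, rfl⟩
        exact hk
    rw [h.semigroupQuot_eq had hs hst h2 h5.le hxs hA] at hk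
    exact irr_closure_subset _ hk

end IsLatticeChain

/-! ### From extensions to solutions -/

/-- Admissible two-sided extensions give solutions. -/
theorem IsTwoSidedExtension.isSolution {I : Finset ℕ} (h0 : 0 ∉ I) (hI : NIndependent (I : Set ℕ))
    {r : ℤ} {n c : ℤ → ℤ} (hn : IsModularConvexEnum I r n) {ν ρ : ℤ} {n' c' : ℤ → ℤ}
    (h : IsTwoSidedExtension r n c ν ρ n' c') {a b d : ℕ} (ht : IsExtTriple n' c' ν ρ a b d)
    (hc : TripleConditions r c' ν ρ a b d) : IsSolution I a b d := by
  obtain ⟨ea, eb, ed⟩ := ht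
  obtain ⟨hab, hy, hlt, hbd, -, hx⟩ := hc
  have hr := hn.one_le
  have hl := h.left
  have hρ := h.right
  have ha0 : 0 < n' ν := h.pos ν le_rfl (by omega)
  have hchain := h.coeffSeq.isLatticeChain (by omega) ha0 (by omega)
  rw [← ea, ← eb, ← ed] at hchain
  have hmd : Int.gcd (extM c' ν ρ) d = 1 := by
    rw [ed, Int.gcd_comm]
    exact (ceilCF (coeffList c' (ν + 1) (ρ - 1))).reduced
  have eb' : (b : ℤ) = d * n' (ν + 1) - extM c' ν ρ * a := by
    rw [eb, extB, ed, ea]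
  -- Since `b = d n_{ν+1} - m a`, a common divisor of `a` and `d` divides `b`; and `b ≡ -m a` modulo
  -- `d` is a product of units.
  have had : Nat.Coprime a d := by
    refine Nat.isCoprime_iff_coprime.1 ?_
    obtain ⟨p, q, e⟩ := hab.isCoprime
    refine ⟨p - q * extM c' ν ρ, q * n' (ν + 1), ?_⟩
    rw [eb'] at e
    linear_combination e
  have hbd' : Nat.Coprime b d := by
    refine Nat.isCoprime_iff_coprime.1 ?_
    have h1 : IsCoprime (extM c' ν ρ * a) (d : ℤ) :=
      (Int.isCoprime_iff_gcd_eq_one.2 hmd).mul_left had.isCoprime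
    obtain ⟨p, q, e⟩ := h1
    refine ⟨-p, q + p * n' (ν + 1), ?_⟩
    rw [eb']
    linear_combination e
  refine ⟨by omega, hlt, hbd, hab, had, hbd', ?_⟩
  have himage : n' '' Set.Icc 0 r = (fun k : ℕ => (k : ℤ)) '' (I : Set ℕ) := by
    rw [← hn.bijOn.image_eq]
    exact Set.image_congr fun i hi => h.seq_eq i hi.1 hi.2
  rw [hchain.semigroupQuot_eq had (s := 0) (t := r) hl (by omega) hρ
    (by simpa using hy) (by simpa using hx) himage]
  exact hI.irr_closure h0

/-! ### From solutions to extensions -/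

/-- Every reduced fraction greater than `1` has a ceiling continued fraction. -/
theorem exists_ceilCF_eq {d m : ℤ} (hm : 0 < m) (hmd : m < d) (h : IsCoprime d m) :
    ∃ l : List ℤ, l ≠ [] ∧ (∀ x ∈ l, 2 ≤ x) ∧ ceilCF l = (d : ℚ) / m := by
  induction hk : m.toNat using Nat.strong_induction_on generalizing d m with
  | _ k ih =>
    rcases (show 1 ≤ m by omega).eq_or_lt with rfl | hm1
    · exact ⟨[d], by simp, by simpa using (by omega : 2 ≤ d), by simp [ceilCF]⟩
    · have e := Int.mul_ediv_add_emod (d + m - 1) m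
      have e1 := Int.emod_nonneg (d + m - 1) hm.ne'
      have e2 := Int.emod_lt_of_pos (d + m - 1) hm
      -- `q` is the ceiling of `d / m`, and `d / m = q - 1 / (m / (q m - d))` has a smaller
      -- denominator inside.
      set q := (d + m - 1) / m with hq
      have hq2 : 2 ≤ q := by rw [hq, Int.le_ediv_iff_mul_le hm]; omega
      have hcop : IsCoprime m (q * m - d) := by
        obtain ⟨u, v, e⟩ := h
        refine ⟨v + u * q, -u, ?_⟩
        linear_combination e
      have hne : q * m - d ≠ 0 := by
        intro h0
        rw [h0, isCoprime_zero_right] at hcop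
        have := Int.isUnit_iff.1 hcop
        omega
      have hpos : 0 < q * m - d := by
        have : 0 ≤ q * m - d := by linarith
        omega
      have hlt : q * m - d < m := by linarith
      obtain ⟨l, -, hl, el⟩ := ih (q * m - d).toNat (by omega) hpos hlt hcop rfl
      refine ⟨q :: l, by simp, ?_, ?_⟩
      · simpa using ⟨hq2, hl⟩
      · rw [ceilCF, el]
        have h1 : (m : ℚ) ≠ 0 := by exact_mod_cast hm.ne'
        have h2 : (((q * m - d : ℤ)) : ℚ) ≠ 0 := by exact_mod_cast hpos.ne'
        push_cast at h2 ⊢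
        field_simp
        ring

theorem coeffList_getD (l : List ℤ) :
    coeffList (fun i => l.getD (i - 1).toNat 2) 1 l.length = l := by
  unfold coeffList
  rw [List.bind_eq_flatMap, List.map_flatMap]
  simp only [List.pure_def, List.map_cons, List.map_nil]
  refine (List.flatMap_pure_eq_map (fun a : ℕ => l.getD (1 + (a : ℤ) - 1).toNat 2) _).trans ?_
  refine List.ext_getElem (by simp) fun i h1 h2 => ?_
  simp [h2]

theorem coeffList_shift (c : ℤ → ℤ) (s p q : ℤ) :
    coeffList (fun i => c (i + s)) p q = coeffList c (p + s) (q + s) := by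
  unfold coeffList
  rw [show q + s + 1 - (p + s) = q + 1 - p by ring]
  congr 1
  funext k
  ring_nf

theorem convNum_shift (c : ℤ → ℤ) (s ν i : ℤ) :
    convNum (fun i => c (i + s)) ν i = convNum c (ν + s) (i + s) := by
  simp only [convNum, coeffList_shift]
  rw [show ν + 1 + s = ν + s + 1 by ring]
  refine if_congr (by omega) rfl (if_congr (by omega) rfl rfl)

theorem convDen_shift (c : ℤ → ℤ) (s ν i : ℤ) :
    convDen (fun i => c (i + s)) ν i = convDen c (ν + s) (i + s) := by
  simp only [convDen, coeffList_shift]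
  rw [show ν + 1 + s = ν + s + 1 by ring]
  refine if_congr (by omega) rfl (if_congr (by omega) rfl rfl)

theorem extD_shift (c : ℤ → ℤ) (s ν ρ : ℤ) :
    extD (fun i => c (i + s)) ν ρ = extD c (ν + s) (ρ + s) := by
  rw [extD, extD, coeffList_shift, show ν + 1 + s = ν + s + 1 by ring,
    show ρ - 1 + s = ρ + s - 1 by ring]

theorem extM_shift (c : ℤ → ℤ) (s ν ρ : ℤ) :
    extM (fun i => c (i + s)) ν ρ = extM c (ν + s) (ρ + s) := by
  rw [extM, extM, coeffList_shift, show ν + 1 + s = ν + s + 1 by ring,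
    show ρ - 1 + s = ρ + s - 1 by ring]

theorem extB_shift (n c : ℤ → ℤ) (s ν ρ : ℤ) :
    extB (fun i => n (i + s)) (fun i => c (i + s)) ν ρ = extB n c (ν + s) (ρ + s) := by
  rw [extB, extB, extD_shift, extM_shift, show ν + 1 + s = ν + s + 1 by ring]

theorem extX_shift (c : ℤ → ℤ) (s ν ρ i : ℤ) :
    extX (fun i => c (i + s)) ν ρ i = extX c (ν + s) (ρ + s) (i + s) := by
  rw [extX, extX, extD_shift, extM_shift, convNum_shift, convDen_shift,
    show i - 1 + s = i + s - 1 by ring]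

theorem IsCoeffSeq.shift {n c : ℤ → ℤ} {ν ρ : ℤ} (h : IsCoeffSeq c n ν ρ) (s : ℤ) :
    IsCoeffSeq (fun i => c (i + s)) (fun i => n (i + s)) (ν - s) (ρ - s) := by
  intro i h1 h2
  have := h (i + s) (by omega) (by omega)
  rw [show i + s + 1 = i + 1 + s by ring, show i + s - 1 = i - 1 + s by ring] at this
  exact this

theorem IsCoeffSeq.mono {n c : ℤ → ℤ} {s t s' t' : ℤ} (h : IsCoeffSeq c n s t) (hs : s ≤ s')
    (ht : t' ≤ t) : IsCoeffSeq c n s' t' := fun i h1 h2 => h i (by omega) (by omega)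

theorem IsCoeffSeq.modularConvexOn {n c : ℤ → ℤ} {s t : ℤ} (h : IsCoeffSeq c n s t) :
    ModularConvexOn n s t := by
  refine ⟨fun i => (c i - 2).toNat, fun i h1 h2 => ?_⟩
  obtain ⟨h3, h4⟩ := h i h1 h2
  rw [h4, nsmul_eq_mul, nsmul_eq_mul, Int.toNat_of_nonneg (by omega)]
  push_cast
  ring

/-- Pairwise coprime `a, b, d` come from the ceiling continued fraction of a fraction `d / m`. -/
theorem exists_isCoeffSeq {a b d : ℕ} (hd : 1 < d) (had : Nat.Coprime a d)
    (hbd : Nat.Coprime b d) :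
    ∃ (ρ : ℤ) (n c : ℤ → ℤ), 1 < ρ ∧ IsCoeffSeq c n 0 ρ ∧ IsExtTriple n c 0 ρ a b d := by
  obtain ⟨u, v, huv⟩ := had.isCoprime
  have hd0 : (0 : ℤ) < d := by omega
  have e := Int.mul_ediv_add_emod (-(b * u)) (d : ℤ)
  -- As `u` inverts `a` modulo `d`, this `m` solves `a m + b ≡ 0`; the quotient `w = (a m + b) / d`
  -- becomes the term after `a`.
  set m : ℤ := (-(b * u)) % d with hm
  have hdvd : (d : ℤ) ∣ a * m + b := by
    refine ⟨b * v - a * (-(b * u) / d), ?_⟩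
    linear_combination (a : ℤ) * e - (b : ℤ) * huv
  obtain ⟨w, hw⟩ := hdvd
  have hcop : IsCoprime (d : ℤ) m := by
    obtain ⟨p, q, hpq⟩ := hbd.isCoprime
    refine ⟨q + p * w, -p * a, ?_⟩
    linear_combination hpq - p * hw
  have hm0 : 0 < m := by
    refine lt_of_le_of_ne (Int.emod_nonneg _ hd0.ne') fun h0 => ?_
    rw [← h0, isCoprime_zero_right] at hcop
    have := Int.isUnit_iff.1 hcop
    omega
  obtain ⟨l, hl, hl2, el⟩ := exists_ceilCF_eq hm0 (Int.emod_lt_of_pos _ hd0) hcop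
  have hlen := List.length_pos_iff.2 hl
  -- The coefficients start at index `1`; the default `2` keeps all of them at least `2`.
  set c : ℤ → ℤ := fun i => l.getD (i - 1).toNat 2 with hc
  have two : ∀ i, 2 ≤ c i := by
    intro i
    rw [hc]
    simp only [List.getD_eq_getElem?_getD]
    rcases lt_or_ge (i - 1).toNat l.length with h | h
    · rw [List.getElem?_eq_getElem h]
      exact hl2 _ (List.getElem_mem h)
    · rw [List.getElem?_eq_none h]
      rfl
  have hD : ceilCF (coeffList c (0 + 1) ((l.length : ℤ) + 1 - 1)) = (d : ℤ) / (m : ℤ) := by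
    rw [add_sub_cancel_right, zero_add, hc, coeffList_getD, el]
  have hgcd := Int.isCoprime_iff_gcd_eq_one.1 hcop
  have eD : extD c 0 (l.length + 1) = d := by
    rw [extD, hD]; exact Rat.num_div_eq_of_coprime hm0 hgcd
  have eM : extM c 0 (l.length + 1) = m := by
    rw [extM, hD]; exact Rat.den_div_eq_of_coprime hm0 hgcd
  have q0 : convNum c 0 (0 - 1) = 0 := convNum_pred c 0
  have p0 : convDen c 0 (0 - 1) = -1 := convDen_pred c 0
  have q1 : convNum c 0 (0 + 1 - 1) = 1 := by rw [add_sub_cancel_right, convNum_self]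
  have p1 : convDen c 0 (0 + 1 - 1) = 0 := by rw [add_sub_cancel_right, convDen_self]
  refine ⟨l.length + 1, fun i => w * convNum c 0 (i - 1) + -a * convDen c 0 (i - 1), c, by omega,
    fun i h1 h2 => ⟨two i, (satisfiesRec_convNum fun i _ _ => two i).linear
      (satisfiesRec_convDen fun i _ _ => two i) w (-a) i h1 h2⟩, ?_, ?_, eD.symm⟩
  · simp only [q0, p0]; ring
  · rw [extB, eD, eM]
    simp only [q0, p0, q1, p1]
    linear_combination hw

/-- Every solution is obtained from a modular-convex enumeration. -/
theorem IsSolution.exists_isObtained {I : Finset ℕ} (hI : (I : Set ℕ).Nontrivial) {a b d : ℕ}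
    (h : IsSolution I a b d) :
    ∃ (r : ℤ) (n c : ℤ → ℤ), IsModularConvexEnum I r n ∧ IsCoeffSeq c n 0 r ∧
      ∃ ν ρ : ℤ, IsObtained r n c ν ρ a b d := by
  obtain ⟨ha, hlt, hbd, hab, had, hbd', hirr⟩ := h
  obtain ⟨ρ, n, c, hρ, hcs, ea, eb, ed⟩ := exists_isCoeffSeq (by omega) had hbd'
  have hchain := hcs.isLatticeChain (by omega) (by omega) (by omega)
  rw [← ea, ← eb, ← ed] at hchain
  obtain ⟨s, t, hs, hst, ht, hy, hx, hx', hbij⟩ := hchain.exists_bijOn_irr had hab hlt hbd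
  rw [hirr] at hbij
  -- A single index would give a single irreducible element, but `I` has two.
  have hst' : s < t := by
    refine lt_of_le_of_ne hst fun e => ?_
    subst e
    obtain ⟨i, hi, j, hj, hij⟩ := hI
    obtain ⟨i', hi', ei⟩ := hbij.surjOn ⟨i, hi, rfl⟩
    obtain ⟨j', hj', ej⟩ := hbij.surjOn ⟨j, hj, rfl⟩
    rw [Set.Icc_self, Set.mem_singleton_iff] at hi' hj'
    subst hi' hj'
    exact hij (Nat.cast_injective (R := ℤ) (ei.symm.trans ej))
  have hcop0 : IsCoprime (n 0) (n (0 + 1)) := by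
    obtain ⟨p, q, e⟩ := hab.isCoprime
    refine ⟨p - q * extM c 0 ρ, q * d, ?_⟩
    rw [eb, extB, ← ed, ea] at e
    linear_combination e
  have hcop := hcs.satisfiesRec.isCoprime hcop0 hs.le (by omega)
  have hshift := hcs.shift s
  have e1 : (0 : ℤ) - s + s = 0 := by ring
  have e2 : ρ - s + s = ρ := by ring
  refine ⟨t - s, fun i => n (i + s), fun i => c (i + s), ⟨by omega, ?_, ?_, ?_⟩,
    hshift.mono (by omega) (by omega), 0 - s, ρ - s, fun i => n (i + s), fun i => c (i + s),
    ⟨by omega, by omega, fun _ _ _ => rfl, fun _ _ _ => rfl, hshift, ?_⟩, ⟨?_, ?_, ?_⟩,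
    hab, ?_, hlt, hbd, ?_, ?_⟩
  · refine ⟨fun i hi => hbij.mapsTo ⟨by linarith [hi.1], by linarith [hi.2]⟩,
      fun i hi j hj e => ?_, fun z hz => ?_⟩
    · have := hbij.injOn (x₁ := i + s) (x₂ := j + s) ⟨by linarith [hi.1], by linarith [hi.2]⟩
        ⟨by linarith [hj.1], by linarith [hj.2]⟩ e
      omega
    · obtain ⟨i, hi, e⟩ := hbij.surjOn hz
      exact ⟨i - s, ⟨by linarith [hi.1], by linarith [hi.2]⟩, by simpa using e⟩
  · exact (hshift.mono (s' := 0) (t' := t - s) (by omega) (by omega)).modularConvexOn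
  · simpa [add_comm] using hcop
  · exact fun i h1 h2 => hchain.n_pos (by omega) (by omega)
  · simp only [e1]; exact ea
  · rw [extB_shift, e1, e2]; exact eb
  · rw [extD_shift, e1, e2]; exact ed
  · rw [convNum_shift, e1, show t - s + s = t + 1 - 1 by ring]; exact hy
  · rw [extX_shift, extX_shift, e1, e2, zero_add, sub_add_cancel]; exact hx
  · rw [extX_shift, extX_shift, e1, e2, sub_add_cancel, show -1 + s = s - 1 by ring]; exact hx'

/-! ### Infinitely many one-step extensions -/

/-- One-step extensions with a prescribed value `p` at the right end, where `p` is a large prime. -/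
theorem exists_isObtained_of_prime {I : Finset ℕ} (h0 : 0 ∉ I) (hI : NIndependent (I : Set ℕ))
    {r : ℤ} {n c : ℤ → ℤ} (hn : IsModularConvexEnum I r n) (hc : IsCoeffSeq c n 0 r)
    {p : ℕ} (hp : p.Prime) (hdvd : n r ∣ p + n (r - 1)) (hp0 : n 0 < p) (hpr : 2 * n r < p)
    (hpa : (n r + n 1 + 2) * n 0 - n 1 < p) :
    ∃ a d : ℕ, IsObtained r n c (-1) (r + 1) a p d := by
  have hr := hn.one_le
  have npos : ∀ i, 0 ≤ i → i ≤ r → 0 < n i := by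
    intro i h1 h2
    obtain ⟨k, hk, e⟩ := hn.bijOn.mapsTo (show i ∈ Set.Icc 0 r from ⟨h1, h2⟩)
    rw [← e]
    have : k ≠ 0 := fun h => h0 (h ▸ hk)
    simp only
    omega
  have hn0 := npos 0 le_rfl (by omega)
  have hn1 := npos 1 (by omega) hr
  have hnr := npos r (by omega) le_rfl
  have hnr1 := npos (r - 1) (by omega) (by omega)
  obtain ⟨C, hC⟩ := hdvd
  have hC2 : 2 ≤ C := by nlinarith
  -- The summand `n 1` makes `a = D n_0 - n_1` positive, and `n r` makes `d` exceed `p`.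
  set D := n r + n 1 + 2 with hD
  set n' : ℤ → ℤ := fun i => if i = -1 then D * n 0 - n 1 else if i = r + 1 then p else n i with hn'
  set c' : ℤ → ℤ := fun i => if i = 0 then D else if i = r then C else c i with hc'
  have nmid : ∀ i, 0 ≤ i → i ≤ r → n' i = n i := by
    intro i h1 h2
    simp only [hn']
    rw [if_neg (by omega), if_neg (by omega)]
  have nl : n' (-1) = D * n 0 - n 1 := by simp [hn']
  have nr : n' (r + 1) = p := by
    simp only [hn']
    rw [if_neg (by omega), if_pos trivial]
  have c0 : c' 0 = D := by simp [hc']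
  have cr : c' r = C := by
    simp only [hc']
    rw [if_neg (by omega), if_pos trivial]
  have hcs : IsCoeffSeq c' n' (-1) (r + 1) := by
    intro i h1 h2
    rcases (show 0 ≤ i by omega).eq_or_lt with rfl | h3
    · rw [c0, zero_add, zero_sub, nl, nmid 0 le_rfl (by omega), nmid 1 (by omega) hr]
      exact ⟨by omega, by ring⟩
    rcases (show i ≤ r by omega).eq_or_lt with rfl | h4
    · rw [cr, nr, nmid i (by omega) le_rfl, nmid (i - 1) (by omega) (by omega)]
      exact ⟨hC2, by linear_combination hC⟩
    · rw [nmid i (by omega) (by omega), nmid (i - 1) (by omega) (by omega),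
        nmid (i + 1) (by omega) (by omega)]
      have : c' i = c i := by
        simp only [hc']
        rw [if_neg (by omega), if_neg (by omega)]
      rw [this]
      exact hc i h3 h4
  have ha : 0 < D * n 0 - n 1 := by nlinarith
  have eb : (p : ℤ) = extB n' c' (-1) (r + 1) := by
    rw [← hcs.right_eq_extB (by omega), nr]
  have hp1 := hp.pos
  have hchain := hcs.isLatticeChain (by omega) (by omega) (by omega)
  have hd := hchain.d_pos
  obtain ⟨a, hae⟩ := Int.eq_ofNat_of_zero_le ha.le
  obtain ⟨d, hde⟩ := Int.eq_ofNat_of_zero_le hd.le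
  have ea : (a : ℤ) = n' (-1) := by rw [nl, hae]
  have hap : a < p := by omega
  have hcop : Nat.Coprime a p :=
    (Nat.coprime_of_lt_prime (by omega) hap hp).symm
  rw [← ea, ← eb, hde] at hchain
  have had : IsCoprime (a : ℤ) d := by
    obtain ⟨u, v, e⟩ := hcop.isCoprime
    refine ⟨u - v * extM c' (-1) (r + 1), v * n' (-1 + 1), ?_⟩
    rw [eb, extB, hde, ← ea] at e
    linear_combination e
  have xr : extX c' (-1) (r + 1) r = 1 := by simpa using hchain.x_right_pred
  have xr0 := hchain.x_right
  -- Otherwise `(x_0 - p, y_0 + a)` lies in the quadrant and has value `n_0`. The chain points below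
  -- it with value at most `n_0 < p` have indices from `1` to `r`, so `n_0` would be generated by
  -- the rest of `I`.
  have x0 : extX c' (-1) (r + 1) 0 ≤ p := by
    by_contra hneg
    have y0 := hchain.y_nonneg (i := 0) (by omega) (by omega)
    have hi0 : ((n 0).toNat : ℤ) = n 0 := by omega
    have hmem : n 0 ∈ AddSubmonoid.closure
        ((fun k : ℕ => (k : ℤ)) '' ((I : Set ℕ) \ {(n 0).toNat})) := by
      refine hchain.mem_of_forall_le had (X := extX c' (-1) (r + 1) 0 - p)
        (Y := convNum c' (-1) (0 - 1) + a) (by omega) (by omega) ?_ _ fun j h1 h2 h3 h4 h5 => ?_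
      · rw [← nmid 0 le_rfl (by omega), hchain.value 0 (by omega) (by omega)]
        ring
      · have hj0 := hchain.lt_of_x_lt (i := 0) (j := j) h1 (by omega) (by omega)
        have hjr : j ≤ r := by
          rcases h2.eq_or_lt with rfl | h2
          · omega
          · omega
        rw [nmid j hj0.le hjr]
        obtain ⟨k, hk, e⟩ := hn.bijOn.mapsTo (show j ∈ Set.Icc 0 r from ⟨hj0.le, hjr⟩)
        refine AddSubmonoid.subset_closure ⟨k, ⟨hk, fun hk0 => ?_⟩, e⟩
        rw [Set.mem_singleton_iff] at hk0
        simp only at e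
        rw [hk0, hi0] at e
        have := hn.bijOn.injOn (show (0 : ℤ) ∈ Set.Icc 0 r from ⟨le_rfl, by omega⟩)
          (show j ∈ Set.Icc 0 r from ⟨hj0.le, hjr⟩) e
        omega
    rw [← hi0, natCast_mem_closure] at hmem
    refine hI _ ?_ hmem
    obtain ⟨k, hk, e⟩ := hn.bijOn.mapsTo (show (0 : ℤ) ∈ Set.Icc 0 r from ⟨le_rfl, by omega⟩)
    simp only at e
    rwa [← e, Int.toNat_natCast]
  -- From `x_1 < x_0` and `x_0 ≥ x_{r-1} = C` follows `d = D x_0 - x_1 > (D - 1) C > n_r C = p +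
  -- n_{r-1}`.
  have hpd : (p : ℤ) < d := by
    have h1 := hchain.recX 0 (by omega) (by omega)
    have h2 := hchain.recX r (by omega) (by omega)
    have h3 := hchain.x_le (i := 0) (j := r - 1) (by omega) (by omega) (by omega)
    have h4 := hchain.x_lt (i := 0) (j := 1) (by omega) (by omega) (by omega)
    have h5 := hchain.x_left
    rw [c0, zero_add, zero_sub, h5] at h1
    rw [cr, xr, xr0] at h2
    nlinarith
  refine ⟨a, d, n', c', ⟨by omega, by omega, fun i h1 h2 => ?_, nmid, hcs, ?_⟩,
    ⟨ea, eb, hde.symm⟩, hcop, ?_, hap, by omega, ?_, ?_⟩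
  · simp only [hc']
    rw [if_neg (by omega), if_neg (by omega)]
  · exact fun i h1 h2 => hchain.n_pos h1 h2
  · have := hchain.y_right
    simp only [add_sub_cancel_right] at this
    omega
  · omega
  · have := hchain.x_left
    omega

theorem theorem3 (I : Finset ℕ) (h0 : 0 ∉ I) (h1 : 1 ∉ I)
    (hI : NIndependent (I : Set ℕ))
    (r : ℤ) (n : ℤ → ℤ) (hn : IsModularConvexEnum I r n)
    (c : ℤ → ℤ) (hc : IsCoeffSeq c n 0 r) :
    -- (i) every admissible two-sided extension gives a solution
    (∀ (ν ρ : ℤ) (n' c' : ℤ → ℤ), IsTwoSidedExtension r n c ν ρ n' c' →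
      n' ρ = extB n' c' ν ρ ∧
      ∀ a b d : ℕ, IsExtTriple n' c' ν ρ a b d → TripleConditions r c' ν ρ a b d →
        IsSolution I a b d) ∧
    -- (ii) every solution comes from some modular-convex enumeration of `I` in this way
    (∀ a b d : ℕ, IsSolution I a b d →
      ∃ (r₁ : ℤ) (n₁ c₁ : ℤ → ℤ), IsModularConvexEnum I r₁ n₁ ∧ IsCoeffSeq c₁ n₁ 0 r₁ ∧
        ∃ ν ρ : ℤ, IsObtained r₁ n₁ c₁ ν ρ a b d) ∧
    -- (iii) one-step extensions on each side already give infinitely many solutions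
    {t : ℕ × ℕ × ℕ | IsSolution I t.1 t.2.1 t.2.2 ∧
      IsObtained r n c (-1) (r + 1) t.1 t.2.1 t.2.2}.Infinite := by
  have hr := hn.one_le
  refine ⟨fun ν ρ n' c' h => ⟨h.coeffSeq.right_eq_extB ?_, fun a b d ht hcond =>
    h.isSolution h0 hI hn ht hcond⟩, fun a b d h => h.exists_isObtained ?_, ?_⟩
  · have := h.left
    have := h.right
    omega
  · obtain ⟨i, hi, ei⟩ := hn.bijOn.mapsTo (show (0 : ℤ) ∈ Set.Icc 0 r from ⟨le_rfl, by omega⟩)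
    obtain ⟨j, hj, ej⟩ := hn.bijOn.mapsTo (show (1 : ℤ) ∈ Set.Icc 0 r from ⟨by omega, hr⟩)
    refine ⟨i, hi, j, hj, fun e => ?_⟩
    subst e
    rw [ei] at ej
    have := hn.bijOn.injOn (show (0 : ℤ) ∈ Set.Icc 0 r from ⟨le_rfl, by omega⟩)
      (show (1 : ℤ) ∈ Set.Icc 0 r from ⟨by omega, hr⟩) ej
    omega
  -- The entries `b = p` are unbounded: `n_{r-1}` is prime to `n_r`, so Dirichlet's theorem applies
  -- to the class of `-n_{r-1}`.
  · refine Set.Infinite.of_image (fun t => t.2.1) (Set.infinite_of_forall_exists_gt fun N => ?_)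
    obtain ⟨k, hk, ek⟩ := hn.bijOn.mapsTo (show r ∈ Set.Icc 0 r from ⟨by omega, le_rfl⟩)
    simp only at ek
    have : NeZero k := ⟨fun h => h0 (h ▸ hk)⟩
    have hcop := hc.satisfiesRec.isCoprime (by simpa using hn.coprime) (show 0 ≤ r - 1 by omega)
      (by omega)
    rw [sub_add_cancel, ← ek] at hcop
    have hunit : IsUnit (-((n (r - 1) : ℤ) : ZMod k)) :=
      ((ZMod.coe_int_isUnit_iff_isCoprime _ _).2 hcop.symm).neg
    obtain ⟨p, hpN, hp, hpk⟩ := Nat.forall_exists_prime_gt_and_eq_mod hunit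
      (N + (n 0).toNat + (2 * n r).toNat + ((n r + n 1 + 2) * n 0 - n 1).toNat)
    have hdvd : n r ∣ p + n (r - 1) := by
      rw [← ek, ← ZMod.intCast_zmod_eq_zero_iff_dvd]
      push_cast
      rw [hpk]
      ring
    obtain ⟨a, d, h⟩ := exists_isObtained_of_prime h0 hI hn hc hp hdvd (by omega) (by omega)
      (by omega)
    have hsol : IsSolution I a p d := by
      obtain ⟨n', c', he, ht, hcond⟩ := h
      exact he.isSolution h0 hI hn ht hcond
    exact ⟨p, ⟨(a, p, d), ⟨hsol, h⟩, rfl⟩, by omega⟩
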